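/- Let $N\ge 1$, $s\in(0,1)$, and let $\Omega\subseteq\mathbb{R}^N$ be a bounded open set with $C^1$ boundary. Let $\mathcal L:=-\Delta+(-\Delta)^s$, and let $$\mathbb X(\Omega):=\{v\in H^1(\mathbb{R}^N):\ v=0\ \text{a.e. in }\mathbb{R}^N\setminus\Omega\},\qquad c_{N,s}:=\left(\int_{\mathbb{R}^N}\frac{1-\cos(\zeta_1)}{|\zeta|^{N+2s}}\,d\zeta\right)^{-1}.$$ Suppose that $u\in H^1(\mathbb{R}^N)$ (real-valued) weakly satisfies $\mathcal L u\ge 0$ in $\Omega$, that is, for every $v\in\mathbb X(\Omega)$ with $v\ge 0$ a.e., $$\int_{\Omega}\langle\nabla u,\nabla v\rangle\,dx+\frac{c_{N,s}}{2}\int_{\mathbb{R}^N\times\mathbb{R}^N}\frac{(u(x)-u(y))(v(x)-v(y))}{|x-y|^{N+2s}}\,dx\,dy\ \ge\ 0 .$$ If $u\ge 0$ a.e. in $\mathbb{R}^N\setminus\Omega$, then $u\ge 0$ a.e. in $\Omega$. -/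

import Mathlib

noncomputable section

namespace MixedOperator

open MeasureTheory
open scoped ContDiff

/-- The Euclidean space `ℝᴺ`. -/
abbrev Space (N : ℕ) : Type := EuclideanSpace ℝ (Fin N)

/-- `G` is the weak (distributional) gradient of `u` on `ℝᴺ`: both are locally integrable and
`∫ u ∂ᵢφ = - ∫ Gᵢ φ` for all `φ ∈ C_c^∞(ℝᴺ)` and all coordinates `i`. -/
def HasWeakGradient {N : ℕ} (u : Space N → ℝ) (G : Space N → Space N) : Prop :=
  LocallyIntegrable u ∧ LocallyIntegrable G ∧
    ∀ φ : Space N → ℝ, ContDiff ℝ ∞ φ → HasCompactSupport φ → ∀ i : Fin N,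
      ∫ x, u x * fderiv ℝ φ x (EuclideanSpace.single i 1) = - ∫ x, G x i * φ x

/-- `u ∈ H¹(ℝᴺ)` (real-valued, functions being identified when they agree a.e.): `u ∈ L²` and
`u` has a weak gradient in `L²`. -/
def MemH1 {N : ℕ} (u : Space N → ℝ) : Prop :=
  MemLp u 2 ∧ ∃ G : Space N → Space N, MemLp G 2 ∧ HasWeakGradient u G

open Classical in
/-- The weak gradient `∇u` (unique up to a null set); it is set to `0` where `u` has no
weak gradient. -/
def weakGradient {N : ℕ} (u : Space N → ℝ) : Space N → Space N :=
  if h : ∃ G : Space N → Space N, HasWeakGradient u G then h.choose else 0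

/-- The space `𝕏(Ω)` of the functions in `H¹(ℝᴺ)` that vanish (a.e.) outside `Ω`. -/
def MemX {N : ℕ} (Ω : Set (Space N)) (v : Space N → ℝ) : Prop :=
  MemH1 v ∧ ∀ᵐ x, x ∉ Ω → v x = 0

/-- The normalizing constant `c_{N,s} = (∫ (1 - cos ζ₁) / |ζ|^{N+2s} dζ)⁻¹` of the fractional
Laplacian; the first coordinate has index `0` in `Fin N`. -/
def fracConst (N : ℕ) [NeZero N] (s : ℝ) : ℝ :=
  (∫ ζ : Space N, (1 - Real.cos (ζ 0)) / ‖ζ‖ ^ ((N : ℝ) + 2 * s))⁻¹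

/-- The bilinear form of `-Δ + (-Δ)^s`: the local part is integrated over `Ω`, the nonlocal
part over `ℝᴺ × ℝᴺ`. -/
def weakForm {N : ℕ} [NeZero N] (s : ℝ) (Ω : Set (Space N)) (u v : Space N → ℝ) : ℝ :=
  (∫ x in Ω, inner ℝ (weakGradient u x) (weakGradient v x)) +
    fracConst N s / 2 *
      ∫ p : Space N × Space N,
        (u p.1 - u p.2) * (v p.1 - v p.2) / ‖p.1 - p.2‖ ^ ((N : ℝ) + 2 * s)

/-- For `u ∈ H¹(ℝᴺ)` and `f ∈ L²(Ω)`: `u` weakly satisfies `-Δu + (-Δ)^s u ≥ f` in `Ω`, tested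
against all nonnegative functions of `𝕏(Ω)`. -/
def WeaklyGE {N : ℕ} [NeZero N] (s : ℝ) (Ω : Set (Space N)) (u f : Space N → ℝ) : Prop :=
  ∀ v : Space N → ℝ, MemX Ω v → (∀ᵐ x, 0 ≤ v x) →
    ∫ x in Ω, f x * v x ≤ weakForm s Ω u v

/-- An open set `Ω` has `C¹` boundary: near each boundary point it is the sublevel set
`{ρ < 0}` of a `C¹` function `ρ` with nonvanishing differential at that point. -/
def HasC1Boundary {N : ℕ} (Ω : Set (Space N)) : Prop :=
  ∀ p ∈ frontier Ω, ∃ U : Set (Space N), IsOpen U ∧ p ∈ U ∧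
    ∃ ρ : Space N → ℝ, ContDiffOn ℝ 1 ρ U ∧ fderiv ℝ ρ p ≠ 0 ∧
      Ω ∩ U = {x ∈ U | ρ x < 0}

end MixedOperator

end

/-!
The inequality is tested with the negative part `v = u⁻ = max (-u) 0`, which vanishes outside `Ω`
because `u ≥ 0` there. As `v` is a nonincreasing function of `u`, the integrand
`(u x - u y) (v x - v y) / |x - y|^(N + 2s)` of the nonlocal term is nowhere positive, and since
`∇v = -1_{u < 0} ∇u` the local term equals `-∫_Ω |∇v|²`. The sum of the two being nonnegative,
`∇v = 0` a.e. in `Ω`, hence everywhere, and a function with vanishing weak gradient and bounded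
support is zero. The sign of the nonlocal integrand is a pointwise fact, so that neither its
integrability nor the exact value of `c_{N,s}` enters.

The analytic input is that `H¹(ℝᴺ)` is stable under negative parts, with the expected gradient
(`MemH1.negPart`). It is proved one direction at a time. Mollification turns weak derivatives into
classical ones (`HasWeakLineDeriv.fderiv_mollify`) and converges in `L¹` on balls
(`tendsto_setIntegral_norm_mollify_sub`), which gives the chain rule for `C¹` functions
(`HasWeakLineDeriv.comp`); the negative part is then a limit of the `C¹` functions
`√((t⁻)² + ε²) - ε` (`HasWeakLineDeriv.negPart`). Mollification also shows that a function with
bounded support and one vanishing directional derivative is zero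
(`HasWeakLineDeriv.ae_eq_zero_of_bounded`).
-/

namespace MixedOperator

open MeasureTheory Filter Topology Metric ContinuousLinearMap
open scoped ContDiff Convolution

/-! ### Mollification -/

section Mollification

/-- A sequence of bump functions centred at the origin whose supports, the balls of radius
`1 / (n + 1)`, shrink to a point while the ratio of outer to inner radius stays equal to `2`. -/
noncomputable def bumpSeq (E : Type*) [NormedAddCommGroup E] [NormedSpace ℝ E] (n : ℕ) :
    ContDiffBump (0 : E) where
  rIn := 1 / ((n : ℝ) + 1) / 2
  rOut := 1 / ((n : ℝ) + 1)
  rIn_pos := by positivity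
  rIn_lt_rOut := half_lt_self (by positivity)

theorem bumpSeq_rOut_le_one {E : Type*} [NormedAddCommGroup E] [NormedSpace ℝ E] (n : ℕ) :
    (bumpSeq E n).rOut ≤ 1 := by
  change 1 / ((n : ℝ) + 1) ≤ 1
  rw [div_le_one (by positivity)]
  linarith [n.cast_nonneg (α := ℝ)]

theorem tendsto_bumpSeq_rOut {E : Type*} [NormedAddCommGroup E] [NormedSpace ℝ E] :
    Tendsto (fun n => (bumpSeq E n).rOut) atTop (𝓝 0) :=
  tendsto_one_div_add_atTop_nhds_zero_nat

variable {E : Type*} [NormedAddCommGroup E] [NormedSpace ℝ E] [FiniteDimensional ℝ E]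
  [MeasurableSpace E] [BorelSpace E] {μ : Measure E} [μ.IsAddHaarMeasure]

/-- The `n`-th mollification `ρₙ ⋆ w` of `w`, where `ρₙ` is the bump function `bumpSeq E n`
normalized to integral one. -/
noncomputable def mollify (μ : Measure E) (n : ℕ) (w : E → ℝ) : E → ℝ :=
  (bumpSeq E n).normed μ ⋆[lsmul ℝ ℝ, μ] w

theorem mollify_apply (n : ℕ) (w : E → ℝ) (x : E) :
    mollify μ n w x = ∫ y, (bumpSeq E n).normed μ (x - y) * w y ∂μ := by
  simp [mollify, convolution_eq_swap]

theorem normed_bumpSeq_eq_zero {n : ℕ} {z : E} (hz : 1 ≤ ‖z‖) :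
    (bumpSeq E n).normed μ z = 0 := by
  rw [← Function.notMem_support, ContDiffBump.support_normed_eq]
  simpa using (bumpSeq_rOut_le_one n).trans hz

theorem mollify_congr_of_eqOn_ball {n : ℕ} {w w' : E → ℝ} {x : E}
    (h : ∀ y ∈ ball x 1, w y = w' y) : mollify μ n w x = mollify μ n w' x := by
  simp only [mollify_apply]
  congr 1 with y
  by_cases hy : y ∈ ball x 1
  · rw [h y hy]
  · rw [normed_bumpSeq_eq_zero, zero_mul, zero_mul]
    simpa [dist_eq_norm_sub'] using hy

theorem convolutionExists_bumpSeq {n : ℕ} {w : E → ℝ} (hw : LocallyIntegrable w μ) :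
    ConvolutionExists ((bumpSeq E n).normed μ) w (lsmul ℝ ℝ) μ :=
  (bumpSeq E n).hasCompactSupport_normed.convolutionExists_left _
    (bumpSeq E n).continuous_normed hw

theorem mollify_add {n : ℕ} {w w' : E → ℝ} (hw : LocallyIntegrable w μ)
    (hw' : LocallyIntegrable w' μ) :
    mollify μ n (w + w') = mollify μ n w + mollify μ n w' :=
  (convolutionExists_bumpSeq hw).distrib_add (convolutionExists_bumpSeq hw')

theorem contDiff_mollify {n : ℕ} {w : E → ℝ} (hw : LocallyIntegrable w μ) :
    ContDiff ℝ 1 (mollify μ n w) :=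
  (bumpSeq E n).hasCompactSupport_normed.contDiff_convolution_left (n := 1) _
    (bumpSeq E n).contDiff_normed hw

theorem integrable_mollify {n : ℕ} {w : E → ℝ} (hw : Integrable w μ) :
    Integrable (mollify μ n w) μ :=
  ((bumpSeq E n).continuous_normed.integrable_of_hasCompactSupport
    (bumpSeq E n).hasCompactSupport_normed).integrable_convolution _ hw

theorem ae_tendsto_mollify {w : E → ℝ} (hw : LocallyIntegrable w μ) :
    ∀ᵐ x ∂μ, Tendsto (fun n => mollify μ n w x) atTop (𝓝 (w x)) :=
  ContDiffBump.ae_convolution_tendsto_right_of_locallyIntegrable (K := 2) tendsto_bumpSeq_rOut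
    (Eventually.of_forall fun n => by
      change 1 / ((n : ℝ) + 1) ≤ 2 * (1 / ((n : ℝ) + 1) / 2)
      linarith) hw

theorem norm_mollify_le (n : ℕ) (w : E → ℝ) (x : E) :
    ‖mollify μ n w x‖ ≤ mollify μ n (fun y => ‖w y‖) x := by
  simp only [mollify_apply]
  refine (norm_integral_le_integral_norm _).trans_eq ?_
  congr 1 with y
  rw [norm_mul, Real.norm_of_nonneg ((bumpSeq E n).nonneg_normed _)]

theorem integral_norm_mollify_le {n : ℕ} {w : E → ℝ} (hw : Integrable w μ) :
    ∫ x, ‖mollify μ n w x‖ ∂μ ≤ ∫ x, ‖w x‖ ∂μ := by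
  have hφ : Integrable ((bumpSeq E n).normed μ) μ :=
    (bumpSeq E n).continuous_normed.integrable_of_hasCompactSupport
      (bumpSeq E n).hasCompactSupport_normed
  calc ∫ x, ‖mollify μ n w x‖ ∂μ ≤ ∫ x, mollify μ n (fun y => ‖w y‖) x ∂μ :=
        integral_mono (integrable_mollify hw).norm (integrable_mollify hw.norm)
          (norm_mollify_le n w)
    _ = ∫ x, ‖w x‖ ∂μ := by
        unfold mollify
        rw [integral_convolution _ hφ hw.norm, (bumpSeq E n).integral_normed]
        simp

theorem tendsto_integral_norm_mollify_sub_of_continuous {g : E → ℝ} (hg : Continuous g)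
    (hgs : HasCompactSupport g) :
    Tendsto (fun n => ∫ x, ‖mollify μ n g x - g x‖ ∂μ) atTop (𝓝 0) := by
  obtain ⟨C, hC⟩ := hgs.exists_bound_of_continuous hg
  have hC0 : 0 ≤ C := (norm_nonneg _).trans (hC 0)
  have hgl : LocallyIntegrable g μ := hg.locallyIntegrable
  have hK : IsCompact (cthickening 1 (tsupport g)) := hgs.isCompact.cthickening
  have hle (n : ℕ) (x : E) : ‖mollify μ n g x - g x‖ ≤ C + C := by
    have : dist (mollify μ n g x) (g x) ≤ C + C :=
      ContDiffBump.dist_normed_convolution_le hg.aestronglyMeasurable fun y _ =>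
        (dist_le_norm_add_norm _ _).trans (add_le_add (hC y) (hC x))
    rwa [dist_eq_norm] at this
  have hz (n : ℕ) (x : E) (hx : x ∉ cthickening 1 (tsupport g)) :
      mollify μ n g x - g x = 0 := by
    have h0 (y : E) (hy : y ∈ ball x 1) : g y = 0 := by
      by_contra hne
      refine hx (mem_cthickening_of_dist_le x y 1 _ (subset_tsupport g hne) ?_)
      rw [dist_comm]; exact (mem_ball.1 hy).le
    rw [mollify_congr_of_eqOn_ball (w' := fun _ => 0) h0, h0 x (mem_ball_self one_pos),
      mollify_apply]
    simp
  rw [show (0 : ℝ) = ∫ x : E, (0 : ℝ) ∂μ by simp]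
  refine tendsto_integral_of_dominated_convergence
    ((cthickening 1 (tsupport g)).indicator fun _ => C + C) (fun n => ?_) ?_ (fun n => ?_) ?_
  · exact (((contDiff_mollify hgl).continuous.sub hg).norm).aestronglyMeasurable
  · exact (integrable_indicator_iff hK.measurableSet).2 (integrableOn_const hK.measure_lt_top.ne)
  · refine Eventually.of_forall fun x => ?_
    by_cases hx : x ∈ cthickening 1 (tsupport g)
    · simpa [hx] using hle n x
    · simp [hx, hz n x hx]
  · refine Eventually.of_forall fun x => ?_
    have := ContDiffBump.convolution_tendsto_right_of_continuous (μ := μ)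
      (tendsto_bumpSeq_rOut (E := E)) hg x
    simpa [mollify] using (this.sub_const (g x)).norm

/-- Mollifications of an integrable function converge to it in `L¹`: by density of `C_c` and the
contraction property `integral_norm_mollify_le`, it suffices to know this for continuous functions
with compact support. -/
theorem tendsto_integral_norm_mollify_sub {h : E → ℝ} (hh : Integrable h μ) :
    Tendsto (fun n => ∫ x, ‖mollify μ n h x - h x‖ ∂μ) atTop (𝓝 0) := by
  rw [Metric.tendsto_atTop]
  intro ε hε
  obtain ⟨g, hgs, hgε, hg, hgi⟩ :=
    hh.exists_hasCompactSupport_integral_sub_le (show 0 < ε / 4 by positivity)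
  obtain ⟨N, hN⟩ := (Metric.tendsto_atTop.1
    (tendsto_integral_norm_mollify_sub_of_continuous (μ := μ) hg hgs)) (ε / 4) (by positivity)
  refine ⟨N, fun n hn => ?_⟩
  have h1 := hN n hn
  rw [Real.dist_0_eq_abs, abs_of_nonneg (integral_nonneg fun _ => norm_nonneg _)] at h1 ⊢
  have hd : Integrable (h - g) μ := hh.sub hgi
  have h2 := integral_norm_mollify_le (n := n) hd
  have hsplit : mollify μ n h = mollify μ n (h - g) + mollify μ n g := by
    rw [← mollify_add hd.locallyIntegrable hgi.locallyIntegrable, sub_add_cancel]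
  have i1 := (integrable_mollify (n := n) hd).norm
  have i2 := ((integrable_mollify (n := n) hgi).sub hgi).norm
  have i3 := hd.norm
  have i12 : Integrable (fun x => ‖mollify μ n (h - g) x‖ + ‖(mollify μ n g - g) x‖) μ := i1.add i2
  calc ∫ x, ‖mollify μ n h x - h x‖ ∂μ
      ≤ ∫ x, (‖mollify μ n (h - g) x‖ + ‖(mollify μ n g - g) x‖ + ‖(h - g) x‖) ∂μ := by
        refine integral_mono ((integrable_mollify hh).sub hh).norm (i12.add i3) fun x => ?_
        have : mollify μ n h x - h x
            = mollify μ n (h - g) x + (mollify μ n g - g) x - (h - g) x := by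
          rw [hsplit]; simp only [Pi.add_apply, Pi.sub_apply]; ring
        dsimp only
        rw [this]
        exact (norm_sub_le _ _).trans (by gcongr; exact norm_add_le _ _)
    _ = ∫ x, ‖mollify μ n (h - g) x‖ ∂μ + ∫ x, ‖(mollify μ n g - g) x‖ ∂μ
          + ∫ x, ‖(h - g) x‖ ∂μ := by
        rw [← integral_add i1 i2, ← integral_add i12 i3]
    _ < ε := by
        simp only [Pi.sub_apply] at h2 ⊢
        linarith

/-- Mollifications of a locally integrable function converge to it in `L¹` on balls. -/
theorem tendsto_setIntegral_norm_mollify_sub {w : E → ℝ} (hw : LocallyIntegrable w μ) (R : ℝ) :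
    Tendsto (fun n => ∫ x in closedBall 0 R, ‖mollify μ n w x - w x‖ ∂μ) atTop (𝓝 0) := by
  have hh : Integrable ((closedBall (0 : E) (R + 1)).indicator w) μ :=
    (integrable_indicator_iff isClosed_closedBall.measurableSet).2
      (hw.integrableOn_isCompact (isCompact_closedBall _ _))
  refine squeeze_zero (fun n => integral_nonneg fun _ => norm_nonneg _) (fun n => ?_)
    (tendsto_integral_norm_mollify_sub hh)
  refine le_trans (le_of_eq ?_) (setIntegral_le_integral (s := closedBall 0 R)
    ((integrable_mollify hh).sub hh).norm (Eventually.of_forall fun _ => norm_nonneg _))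
  refine setIntegral_congr_fun isClosed_closedBall.measurableSet fun x hx => ?_
  have hb (y : E) (hy : y ∈ ball x 1) : w y = (closedBall (0 : E) (R + 1)).indicator w y := by
    rw [Set.indicator_of_mem]
    rw [mem_closedBall] at hx ⊢
    linarith [dist_triangle y x 0, mem_ball.1 hy]
  rw [mollify_congr_of_eqOn_ball hb, ← hb x (mem_ball_self one_pos)]

end Mollification

/-! ### Weak directional derivatives and the chain rule -/

/-- `g` is the weak derivative of `u` in the direction `e`: both functions are locally integrable
and `∫ u ∂ₑφ = - ∫ g φ` for all test functions `φ`. -/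
structure HasWeakLineDeriv {E : Type*} [NormedAddCommGroup E] [NormedSpace ℝ E]
    [MeasurableSpace E] (μ : Measure E) (u g : E → ℝ) (e : E) : Prop where
  locallyIntegrable : LocallyIntegrable u μ
  locallyIntegrable_deriv : LocallyIntegrable g μ
  integral_eq : ∀ φ : E → ℝ, ContDiff ℝ ∞ φ → HasCompactSupport φ →
    ∫ x, u x * fderiv ℝ φ x e ∂μ = - ∫ x, g x * φ x ∂μ

theorem abs_le_abs_sub_of_hasDerivAt {F f : ℝ → ℝ} (hF : ∀ t, HasDerivAt F (f t) t)
    (hb : ∀ t, |f t| ≤ 1) (a b : ℝ) : |F a - F b| ≤ |a - b| := by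
  have := Convex.norm_image_sub_le_of_norm_deriv_le (f := F) (s := Set.univ) (C := 1) (x := b)
    (y := a) (fun t _ => (hF t).differentiableAt) (fun t _ => by rw [(hF t).deriv]; exact hb t)
    convex_univ (Set.mem_univ _) (Set.mem_univ _)
  simpa using this

section ChainRule

variable {E : Type*} [NormedAddCommGroup E] [NormedSpace ℝ E] [FiniteDimensional ℝ E]
  [MeasurableSpace E] [BorelSpace E] {μ : Measure E} [μ.IsAddHaarMeasure]

/-- Mollification turns weak derivatives into classical ones. -/
theorem HasWeakLineDeriv.fderiv_mollify {u g : E → ℝ} {e : E} (h : HasWeakLineDeriv μ u g e)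
    (n : ℕ) (x : E) : fderiv ℝ (mollify μ n u) x e = mollify μ n g x := by
  set ρ := (bumpSeq E n).normed μ with hρ
  have hρs : HasCompactSupport ρ := (bumpSeq E n).hasCompactSupport_normed
  have hρd : ContDiff ℝ ∞ ρ := (bumpSeq E n).contDiff_normed
  have hflip : mollify μ n u = u ⋆[(lsmul ℝ ℝ).flip, μ] ρ :=
    (convolution_flip (L := lsmul ℝ ℝ) (f := ρ) (g := u)).symm
  rw [hflip, (hρs.hasFDerivAt_convolution_right _ h.locallyIntegrable
      (hρd.of_le (by simp)) x).fderiv,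
    convolution_precompR_apply _ h.locallyIntegrable (hρs.fderiv ℝ)
      (hρd.continuous_fderiv (by simp)), mollify_apply]
  have hψ := h.integral_eq (fun y => ρ (x - y)) (hρd.comp (contDiff_const.sub contDiff_id))
    (hρs.comp_homeomorph (Homeomorph.subLeft x))
  have hder (y : E) : fderiv ℝ (fun y => ρ (x - y)) y e = - fderiv ℝ ρ (x - y) e := by
    have h1 : HasFDerivAt ρ (fderiv ℝ ρ (x - y)) (x - y) :=
      (hρd.differentiable (by simp) _).hasFDerivAt
    have h2 : HasFDerivAt (fun y : E => x - y) (-ContinuousLinearMap.id ℝ E) y :=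
      (hasFDerivAt_id y).const_sub x
    have h3 : HasFDerivAt (fun y => ρ (x - y)) _ y := h1.comp y h2
    rw [h3.fderiv]
    simp
  simp only [hder, mul_neg, integral_neg, neg_inj] at hψ
  simp only [convolution_def, flip_apply, lsmul_apply, smul_eq_mul]
  simpa [mul_comm, hρ] using hψ

theorem tendsto_integral_zero_of_norm_le_mollify_sub {w : E → ℝ} (hw : LocallyIntegrable w μ)
    {c : ℕ → E → ℝ} {C R : ℝ}
    (hc : ∀ n x, ‖c n x‖ ≤ (closedBall 0 R).indicator (fun x => C * ‖mollify μ n w x - w x‖) x) :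
    Tendsto (fun n => ∫ x, c n x ∂μ) atTop (𝓝 0) := by
  refine squeeze_zero_norm (fun n => norm_integral_le_of_norm_le ?_ (Eventually.of_forall (hc n)))
    ?_
  · rw [integrable_indicator_iff isClosed_closedBall.measurableSet]
    exact ((((contDiff_mollify hw).continuous.locallyIntegrable.sub
      hw).integrableOn_isCompact (isCompact_closedBall _ _)).norm).const_mul C
  · simp only [integral_indicator isClosed_closedBall.measurableSet, integral_const_mul]
    simpa using (tendsto_setIntegral_norm_mollify_sub hw R).const_mul C

/-- The chain rule for weak derivatives: if `F` is `C¹` with `F 0 = 0` and `|F'| ≤ 1`, then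
`F ∘ u` has the weak derivative `F'(u) ∂ₑu`. -/
theorem HasWeakLineDeriv.comp {u g : E → ℝ} {e : E} (h : HasWeakLineDeriv μ u g e)
    {F f : ℝ → ℝ} (hF : ∀ t, HasDerivAt F (f t) t) (hf : Continuous f) (hb : ∀ t, |f t| ≤ 1)
    (hF0 : F 0 = 0) :
    HasWeakLineDeriv μ (fun x => F (u x)) (fun x => f (u x) * g x) e := by
  have hu := h.locallyIntegrable
  have hg := h.locallyIntegrable_deriv
  have hLip := abs_le_abs_sub_of_hasDerivAt hF hb
  have hFc : Continuous F := continuous_iff_continuousAt.2 fun t => (hF t).continuousAt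
  have hFu : LocallyIntegrable (fun x => F (u x)) μ :=
    hu.mono (hFc.comp_aestronglyMeasurable hu.aestronglyMeasurable)
      (Eventually.of_forall fun x => by simpa [hF0] using hLip (u x) 0)
  have hfg : LocallyIntegrable (fun x => f (u x) * g x) μ :=
    hg.mono ((hf.comp_aestronglyMeasurable hu.aestronglyMeasurable).mul hg.aestronglyMeasurable)
      (Eventually.of_forall fun x => by
        rw [norm_mul]
        exact mul_le_of_le_one_left (norm_nonneg _) (hb _))
  refine ⟨hFu, hfg, fun φ hφ hφs => ?_⟩
  have hφc : Continuous φ := hφ.continuous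
  have hdc : Continuous fun x => fderiv ℝ φ x e :=
    (hφ.continuous_fderiv (by simp)).clm_apply continuous_const
  have hds : HasCompactSupport fun x => fderiv ℝ φ x e := hφs.fderiv_apply ℝ e
  obtain ⟨C, hC⟩ := hφs.exists_bound_of_continuous hφc
  obtain ⟨C', hC'⟩ := hds.exists_bound_of_continuous hdc
  obtain ⟨R, hR⟩ := hφs.isCompact.isBounded.subset_closedBall 0
  have hφ0 (x : E) (hx : x ∉ closedBall (0 : E) R) : φ x = 0 :=
    image_eq_zero_of_notMem_tsupport fun h => hx (hR h)
  have hd0 (x : E) (hx : x ∉ closedBall (0 : E) R) : fderiv ℝ φ x e = 0 := by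
    rw [image_eq_zero_of_notMem_tsupport fun h => hx (hR (tsupport_fderiv_subset ℝ h))]
    simp
  have hun (n : ℕ) : ContDiff ℝ 1 (mollify μ n u) := contDiff_mollify hu
  have hgn (n : ℕ) : ContDiff ℝ 1 (mollify μ n g) := contDiff_mollify hg
  have hI (w : E → ℝ) (hw : LocallyIntegrable w μ) (ψ : E → ℝ) (hψ : Continuous ψ)
      (hψs : HasCompactSupport ψ) : Integrable (fun x => w x * ψ x) μ :=
    hw.integrable_smul_right_of_hasCompactSupport hψ hψs
  -- The identity for the smooth functions `F ∘ mollify μ n u` is classical integration by parts.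
  have hparts (n : ℕ) : ∫ x, F (mollify μ n u x) * fderiv ℝ φ x e ∂μ
      = - ∫ x, f (mollify μ n u x) * mollify μ n g x * φ x ∂μ := by
    have hd (x : E) : HasFDerivAt (fun x => F (mollify μ n u x))
        (f (mollify μ n u x) • fderiv ℝ (mollify μ n u) x) x :=
      (hF _).comp_hasFDerivAt x ((hun n).differentiable (by simp) x).hasFDerivAt
    have hd' (x : E) : fderiv ℝ (fun x => F (mollify μ n u x)) x e
        = f (mollify μ n u x) * mollify μ n g x := by
      rw [(hd x).fderiv, smul_apply, h.fderiv_mollify, smul_eq_mul]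
    have hFn : Continuous fun x => F (mollify μ n u x) := hFc.comp (hun n).continuous
    have hfn : Continuous fun x => f (mollify μ n u x) * mollify μ n g x :=
      (hf.comp (hun n).continuous).mul (hgn n).continuous
    rw [integral_mul_fderiv_eq_neg_fderiv_mul_of_integrable]
    · simp only [hd']
    · simp only [hd']
      exact hI _ hfn.locallyIntegrable _ hφc hφs
    · exact hI _ hFn.locallyIntegrable _ hdc hds
    · exact hI _ hFn.locallyIntegrable _ hφc hφs
    · exact fun x _ => (hd x).differentiableAt
    · exact fun x _ => hφ.differentiable (by simp) x
  have hleft : Tendsto (fun n => ∫ x, F (mollify μ n u x) * fderiv ℝ φ x e ∂μ) atTop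
      (𝓝 (∫ x, F (u x) * fderiv ℝ φ x e ∂μ)) := by
    have h0 : Tendsto (fun n => ∫ x, (F (mollify μ n u x) - F (u x)) * fderiv ℝ φ x e ∂μ) atTop
        (𝓝 0) := by
      refine tendsto_integral_zero_of_norm_le_mollify_sub hu (C := C') (R := R) fun n x => ?_
      by_cases hx : x ∈ closedBall (0 : E) R
      · rw [Set.indicator_of_mem hx, norm_mul, mul_comm]
        exact mul_le_mul (hC' x) (hLip _ _) (norm_nonneg _) ((norm_nonneg _).trans (hC' x))
      · simp [Set.indicator_of_notMem hx, hd0 x hx]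
    have := h0.add_const (∫ x, F (u x) * fderiv ℝ φ x e ∂μ)
    rw [zero_add] at this
    refine this.congr fun n => ?_
    simp only [sub_mul]
    have hFn : Continuous fun x => F (mollify μ n u x) := hFc.comp (hun n).continuous
    rw [integral_sub (hI _ hFn.locallyIntegrable _ hdc hds) (hI _ hFu _ hdc hds), sub_add_cancel]
  have hright : Tendsto (fun n => ∫ x, f (mollify μ n u x) * mollify μ n g x * φ x ∂μ) atTop
      (𝓝 (∫ x, f (u x) * g x * φ x ∂μ)) := by
    have h0 : Tendsto (fun n => ∫ x, f (mollify μ n u x) * (mollify μ n g x - g x) * φ x ∂μ)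
        atTop (𝓝 0) := by
      refine tendsto_integral_zero_of_norm_le_mollify_sub hg (C := C) (R := R) fun n x => ?_
      by_cases hx : x ∈ closedBall (0 : E) R
      · rw [Set.indicator_of_mem hx, norm_mul, norm_mul, mul_comm]
        exact mul_le_mul (hC x) (mul_le_of_le_one_left (norm_nonneg _) (hb _))
          (by positivity) ((norm_nonneg _).trans (hC x))
      · simp [Set.indicator_of_notMem hx, hφ0 x hx]
    have hmeas (n : ℕ) : AEStronglyMeasurable (fun x => f (mollify μ n u x)) μ :=
      (hf.comp (hun n).continuous).aestronglyMeasurable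
    have h1 : Tendsto (fun n => ∫ x, f (mollify μ n u x) * (g x * φ x) ∂μ)
        atTop (𝓝 (∫ x, f (u x) * (g x * φ x) ∂μ)) := by
      refine tendsto_integral_of_dominated_convergence (fun x => ‖g x * φ x‖)
        (fun n => (hmeas n).mul (hI g hg φ hφc hφs).aestronglyMeasurable)
        (hI g hg φ hφc hφs).norm (fun n => Eventually.of_forall fun x => ?_) ?_
      · rw [norm_mul]
        exact mul_le_of_le_one_left (norm_nonneg _) (hb _)
      · filter_upwards [ae_tendsto_mollify hu] with x hx
        exact ((hf.tendsto _).comp hx).mul_const _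
    have := h0.add h1
    simp only [zero_add, ← mul_assoc] at this
    refine this.congr fun n => ?_
    have hfw (w : E → ℝ) (hw : LocallyIntegrable w μ) :
        Integrable (fun x => f (mollify μ n u x) * w x * φ x) μ := by
      refine hI _ (hw.mono ((hmeas n).mul hw.aestronglyMeasurable)
        (Eventually.of_forall fun x => ?_)) φ hφc hφs
      rw [Pi.mul_apply, norm_mul]
      exact mul_le_of_le_one_left (norm_nonneg _) (hb _)
    rw [← integral_add (hfw (fun x => mollify μ n g x - g x)
      ((hgn n).continuous.locallyIntegrable.sub hg)) (hfw g hg)]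
    congr 1 with x
    ring
  refine tendsto_nhds_unique hleft ?_
  simp only [hparts]
  exact hright.neg

theorem hasDerivAt_max_neg_sq (t : ℝ) :
    HasDerivAt (fun t : ℝ => max (-t) 0 ^ 2) (-2 * max (-t) 0) t := by
  have hne (y : ℝ) (hy : y ≠ 0) :
      HasDerivAt (fun t : ℝ => max (-t) 0 ^ 2) (-2 * max (-y) 0) y := by
    rcases lt_or_gt_of_ne hy with hy | hy
    · have h1 : HasDerivAt (fun t : ℝ => t ^ 2) (-2 * max (-y) 0) y := by
        rw [max_eq_left (by linarith)]
        simpa using hasDerivAt_pow 2 y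
      refine h1.congr_of_eventuallyEq ?_
      filter_upwards [gt_mem_nhds hy] with z hz
      rw [max_eq_left (by linarith)]
      ring
    · have h1 : HasDerivAt (fun _ : ℝ => (0 : ℝ)) (-2 * max (-y) 0) y := by
        rw [max_eq_right (by linarith)]
        simpa using hasDerivAt_const y (0 : ℝ)
      refine h1.congr_of_eventuallyEq ?_
      filter_upwards [lt_mem_nhds hy] with z hz
      rw [max_eq_right (by linarith)]
      ring
  by_cases ht : t = 0
  · subst ht
    exact hasDerivAt_of_hasDerivAt_of_ne hne
      (by fun_prop) (by fun_prop)
  · exact hne t ht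

/-- The negative part of a weakly differentiable function is weakly differentiable, with derivative
`-∂ₑu` on `{u < 0}` and `0` elsewhere. It is the limit of the `C¹` functions
`√((u⁻)² + ε²) - ε` of `u`. -/
theorem HasWeakLineDeriv.negPart {u g : E → ℝ} {e : E} (h : HasWeakLineDeriv μ u g e) :
    HasWeakLineDeriv μ (fun x => max (-u x) 0) (fun x => (if u x < 0 then -1 else 0) * g x) e := by
  have hu := h.locallyIntegrable
  have hg := h.locallyIntegrable_deriv
  let ε : ℕ → ℝ := fun n => 1 / ((n : ℝ) + 1)
  have hε (n : ℕ) : 0 < ε n := by positivity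
  have hε0 : Tendsto ε atTop (𝓝 0) := tendsto_one_div_add_atTop_nhds_zero_nat
  let F : ℕ → ℝ → ℝ := fun n t => √(max (-t) 0 ^ 2 + ε n ^ 2) - ε n
  let f : ℕ → ℝ → ℝ := fun n t => -max (-t) 0 / √(max (-t) 0 ^ 2 + ε n ^ 2)
  have hpos (n : ℕ) (t : ℝ) : 0 < max (-t) 0 ^ 2 + ε n ^ 2 := by have := hε n; positivity
  have hF (n : ℕ) (t : ℝ) : HasDerivAt (F n) (f n t) t := by
    have := ((((hasDerivAt_max_neg_sq t).add_const (ε n ^ 2)).sqrt (hpos n t).ne').sub_const (ε n))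
    refine this.congr_deriv ?_
    change _ = -max (-t) 0 / _
    have := (Real.sqrt_pos.2 (hpos n t)).ne'
    field_simp
  have hf (n : ℕ) : Continuous (f n) := by
    refine Continuous.div (by fun_prop) (by fun_prop) fun t => (Real.sqrt_pos.2 (hpos n t)).ne'
  have hb (n : ℕ) (t : ℝ) : |f n t| ≤ 1 := by
    rw [abs_div, abs_neg, abs_of_nonneg (le_max_right _ _), abs_of_nonneg (Real.sqrt_nonneg _),
      div_le_one (Real.sqrt_pos.2 (hpos n t))]
    exact Real.le_sqrt_of_sq_le (by nlinarith [hε n])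
  have hF0 (n : ℕ) : F n 0 = 0 := by simp [F, Real.sqrt_sq (hε n).le]
  have hFle (n : ℕ) (t : ℝ) : |F n t| ≤ |t| := by
    simpa [hF0] using abs_le_abs_sub_of_hasDerivAt (hF n) (hb n) t 0
  have hFlim (t : ℝ) : Tendsto (fun n => F n t) atTop (𝓝 (max (-t) 0)) := by
    have : Tendsto (fun n => F n t) atTop (𝓝 (√(max (-t) 0 ^ 2 + 0 ^ 2) - 0)) :=
      (((hε0.pow 2).const_add _).sqrt).sub hε0
    simpa [Real.sqrt_sq (le_max_right (-t) 0)] using this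
  have hflim (t : ℝ) : Tendsto (fun n => f n t) atTop (𝓝 (if t < 0 then -1 else 0)) := by
    split_ifs with ht
    · have : Tendsto (fun n => f n t) atTop (𝓝 (-max (-t) 0 / √(max (-t) 0 ^ 2 + 0 ^ 2))) := by
        refine (tendsto_const_nhds (x := -max (-t) 0)).div
          (((hε0.pow 2).const_add _).sqrt) ?_
        rw [max_eq_left (by linarith)]
        exact (Real.sqrt_pos.2 (by nlinarith)).ne'
      rw [max_eq_left (by linarith)] at this
      have h2 : √((-t) ^ 2 + 0 ^ 2) = -t := by
        rw [zero_pow two_ne_zero, add_zero, Real.sqrt_sq (by linarith)]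
      rw [h2, neg_div, div_self (by linarith)] at this
      exact this
    · have : (fun n => f n t) = fun _ => 0 := by
        funext n
        simp [f, max_eq_right (show -t ≤ 0 by linarith)]
      rw [this]
      exact tendsto_const_nhds
  have hsgn : Measurable fun t : ℝ => if t < 0 then (-1 : ℝ) else 0 :=
    Measurable.ite measurableSet_Iio measurable_const measurable_const
  refine ⟨?_, ?_, fun φ hφ hφs => ?_⟩
  · refine hu.mono (hu.aestronglyMeasurable.neg.sup aestronglyMeasurable_const)
      (Eventually.of_forall fun x => ?_)
    rw [Real.norm_of_nonneg (le_max_right _ _)]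
    exact max_le (neg_le_abs _) (norm_nonneg _)
  · refine hg.mono ((hsgn.comp_aemeasurable
      hu.aestronglyMeasurable.aemeasurable).aestronglyMeasurable.mul hg.aestronglyMeasurable)
      (Eventually.of_forall fun x => ?_)
    split_ifs <;> simp
  have hφc : Continuous φ := hφ.continuous
  have hdc : Continuous fun x => fderiv ℝ φ x e :=
    (hφ.continuous_fderiv (by simp)).clm_apply continuous_const
  have hds : HasCompactSupport fun x => fderiv ℝ φ x e := hφs.fderiv_apply ℝ e
  have hud : Integrable (fun x => u x * fderiv ℝ φ x e) μ :=
    hu.integrable_smul_right_of_hasCompactSupport hdc hds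
  have hgφ : Integrable (fun x => g x * φ x) μ :=
    hg.integrable_smul_right_of_hasCompactSupport hφc hφs
  have hFc (n : ℕ) : Continuous (F n) :=
    continuous_iff_continuousAt.2 fun t => (hF n t).continuousAt
  have hleft : Tendsto (fun n => ∫ x, F n (u x) * fderiv ℝ φ x e ∂μ) atTop
      (𝓝 (∫ x, max (-u x) 0 * fderiv ℝ φ x e ∂μ)) := by
    refine tendsto_integral_of_dominated_convergence (fun x => ‖u x * fderiv ℝ φ x e‖)
      (fun n => ((hFc n).comp_aestronglyMeasurable hu.aestronglyMeasurable).mul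
        hdc.aestronglyMeasurable) hud.norm (fun n => Eventually.of_forall fun x => ?_)
      (Eventually.of_forall fun x => (hFlim _).mul_const _)
    rw [norm_mul, norm_mul]
    exact mul_le_mul_of_nonneg_right (hFle n _) (norm_nonneg _)
  have hright : Tendsto (fun n => ∫ x, f n (u x) * (g x * φ x) ∂μ) atTop
      (𝓝 (∫ x, (if u x < 0 then -1 else 0) * (g x * φ x) ∂μ)) := by
    refine tendsto_integral_of_dominated_convergence (fun x => ‖g x * φ x‖)
      (fun n => ((hf n).comp_aestronglyMeasurable hu.aestronglyMeasurable).mul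
        hgφ.aestronglyMeasurable) hgφ.norm (fun n => Eventually.of_forall fun x => ?_)
      (Eventually.of_forall fun x => (hflim _).mul_const _)
    rw [norm_mul]
    exact mul_le_of_le_one_left (norm_nonneg _) (hb n _)
  refine tendsto_nhds_unique hleft ?_
  simp only [(h.comp (hF _) (hf _) (hb _) (hF0 _)).integral_eq φ hφ hφs, mul_assoc]
  exact hright.neg

/-- A function with bounded support whose weak derivative in one nonzero direction `e` vanishes is
zero: its mollifications are constant along lines parallel to `e` and have bounded support. -/
theorem HasWeakLineDeriv.ae_eq_zero_of_bounded {v : E → ℝ} {e : E} (he : e ≠ 0)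
    (h : HasWeakLineDeriv μ v (fun _ => 0) e) {Ω : Set E} (hΩ : Bornology.IsBounded Ω)
    (hv : ∀ᵐ x ∂μ, x ∉ Ω → v x = 0) : ∀ᵐ x ∂μ, v x = 0 := by
  obtain ⟨R, hR⟩ := hΩ.subset_closedBall 0
  have hzero (n : ℕ) (x : E) : mollify μ n v x = 0 := by
    have hder (t : ℝ) : HasDerivAt (fun t : ℝ => mollify μ n v (x + t • e)) 0 t := by
      have h1 := ((contDiff_mollify (n := n) h.locallyIntegrable).differentiable (by simp)
        (x + t • e)).hasFDerivAt
      have h2 : HasDerivAt (fun t : ℝ => x + t • e) e t := by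
        simpa using ((hasDerivAt_id t).smul_const e).const_add x
      have h3 := h1.comp_hasDerivAt t h2
      rw [h.fderiv_mollify, mollify_apply] at h3
      exact h3.congr_deriv (by simp)
    have hconst := is_const_of_deriv_eq_zero (fun t => (hder t).differentiableAt)
      (fun t => (hder t).deriv) 0 ((R + 1 + ‖x‖) / ‖e‖)
    simp only [zero_smul, add_zero] at hconst
    rw [hconst, mollify_apply]
    refine integral_eq_zero_of_ae ?_
    filter_upwards [hv] with y hy
    by_cases hyΩ : y ∈ Ω
    · -- The point at which the mollification is evaluated has distance at least `1` from `Ω`.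
      have hyR : ‖y‖ ≤ R := by simpa using hR hyΩ
      have hR0 : 0 ≤ R := (norm_nonneg y).trans hyR
      have hn : ‖((R + 1 + ‖x‖) / ‖e‖) • e‖ = R + 1 + ‖x‖ := by
        rw [norm_smul, Real.norm_of_nonneg (by positivity),
          div_mul_cancel₀ _ (norm_ne_zero_iff.2 he)]
      rw [normed_bumpSeq_eq_zero, zero_mul, Pi.zero_apply]
      set z := ((R + 1 + ‖x‖) / ‖e‖) • e
      have h1 : ‖z‖ ≤ ‖x + z - y‖ + ‖y‖ + ‖x‖ := by
        calc ‖z‖ = ‖(x + z - y) + y - x‖ := by congr 1; abel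
          _ ≤ _ := (norm_sub_le _ _).trans (by gcongr; exact norm_add_le _ _)
      linarith
    · simp [hy hyΩ]
  filter_upwards [ae_tendsto_mollify h.locallyIntegrable] with x hx
  simp only [hzero] at hx
  exact tendsto_nhds_unique hx tendsto_const_nhds

end ChainRule

/-! ### Weak gradients -/

section WeakGradient

variable {N : ℕ}

theorem abs_coord_le_norm (y : Space N) (i : Fin N) : |y i| ≤ ‖y‖ := by
  simpa using PiLp.norm_apply_le y i

theorem HasWeakGradient.hasWeakLineDeriv {u : Space N → ℝ} {G : Space N → Space N}
    (h : HasWeakGradient u G) (i : Fin N) :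
    HasWeakLineDeriv volume u (fun x => G x i) (EuclideanSpace.single i 1) where
  locallyIntegrable := h.1
  locallyIntegrable_deriv := h.2.1.mono
    ((EuclideanSpace.proj (𝕜 := ℝ) i).continuous.comp_aestronglyMeasurable
      h.2.1.aestronglyMeasurable) (Eventually.of_forall fun _ => abs_coord_le_norm _ _)
  integral_eq φ hφ hφs := h.2.2 φ hφ hφs i

/-- Weak gradients are unique up to a null set. -/
theorem HasWeakGradient.ae_eq {u : Space N → ℝ} {G G' : Space N → Space N}
    (h : HasWeakGradient u G) (h' : HasWeakGradient u G') : ∀ᵐ x, G x = G' x := by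
  have (i : Fin N) : ∀ᵐ x, G x i = G' x i := by
    refine ae_eq_of_integral_contDiff_smul_eq (h.hasWeakLineDeriv i).locallyIntegrable_deriv
      (h'.hasWeakLineDeriv i).locallyIntegrable_deriv fun φ hφ hφs => ?_
    have h1 := h.2.2 φ hφ hφs i
    rw [h'.2.2 φ hφ hφs i, neg_inj] at h1
    simpa [mul_comm] using h1.symm
  filter_upwards [ae_all_iff.2 this] with x hx
  ext i
  exact hx i

theorem HasWeakGradient.to_weakGradient {u : Space N → ℝ} {G : Space N → Space N}
    (h : HasWeakGradient u G) : HasWeakGradient u (weakGradient u) := by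
  have hex : ∃ G : Space N → Space N, HasWeakGradient u G := ⟨G, h⟩
  rw [weakGradient, dif_pos hex]
  exact hex.choose_spec

theorem MemH1.hasWeakGradient {u : Space N → ℝ} (h : MemH1 u) :
    HasWeakGradient u (weakGradient u) := by
  obtain ⟨-, G, -, hG⟩ := h
  exact hG.to_weakGradient

theorem MemH1.memLp_weakGradient {u : Space N → ℝ} (h : MemH1 u) : MemLp (weakGradient u) 2 := by
  obtain ⟨-, G, hG2, hG⟩ := h
  exact hG2.ae_eq (hG.ae_eq hG.to_weakGradient)

/-- `H¹` is stable under taking negative parts, and `∇(u⁻) = -1_{u < 0} ∇u`. -/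
theorem MemH1.negPart {u : Space N → ℝ} (h : MemH1 u) :
    MemH1 (fun x => max (-u x) 0) ∧ ∀ᵐ x, weakGradient (fun x => max (-u x) 0) x
      = (if u x < 0 then (-1 : ℝ) else 0) • weakGradient u x := by
  have hG := h.hasWeakGradient
  have hsgn : Measurable fun t : ℝ => if t < 0 then (-1 : ℝ) else 0 :=
    Measurable.ite measurableSet_Iio measurable_const measurable_const
  have hH : MemLp (fun x => (if u x < 0 then (-1 : ℝ) else 0) • weakGradient u x) 2 := by
    refine h.memLp_weakGradient.of_le ((hsgn.comp_aemeasurable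
      h.1.1.aemeasurable).aestronglyMeasurable.smul hG.2.1.aestronglyMeasurable)
      (Eventually.of_forall fun x => ?_)
    split_ifs <;> simp
  have hv : MemLp (fun x => max (-u x) 0) 2 := by
    refine h.1.of_le (h.1.1.neg.sup aestronglyMeasurable_const) (Eventually.of_forall fun x => ?_)
    rw [Real.norm_of_nonneg (le_max_right _ _)]
    exact max_le (neg_le_abs _) (norm_nonneg _)
  have hvH : HasWeakGradient (fun x => max (-u x) 0)
      (fun x => (if u x < 0 then (-1 : ℝ) else 0) • weakGradient u x) := by
    refine ⟨hv.locallyIntegrable (by norm_num), hH.locallyIntegrable (by norm_num),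
      fun φ hφ hφs i => ?_⟩
    simpa only [PiLp.smul_apply, smul_eq_mul] using
      (hG.hasWeakLineDeriv i).negPart.integral_eq φ hφ hφs
  exact ⟨⟨hv, _, hH, hvH⟩, hvH.to_weakGradient.ae_eq hvH⟩

end WeakGradient

/-! ### Sign of the nonlocal term -/

/-- The constant is nonnegative whether or not its defining integral converges, since both the
integral of a nonintegrable function and the inverse of zero are zero. -/
theorem fracConst_nonneg (N : ℕ) [NeZero N] (s : ℝ) : 0 ≤ fracConst N s :=
  inv_nonneg.2 (integral_nonneg fun ζ =>
    div_nonneg (by linarith [Real.cos_le_one (ζ 0)]) (Real.rpow_nonneg (norm_nonneg _) _))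

theorem sub_mul_max_neg_sub_nonpos (a b : ℝ) : (a - b) * (max (-a) 0 - max (-b) 0) ≤ 0 := by
  rcases le_total a b with h | h
  · exact mul_nonpos_of_nonpos_of_nonneg (by linarith)
      (sub_nonneg.2 (max_le_max (neg_le_neg h) le_rfl))
  · exact mul_nonpos_of_nonneg_of_nonpos (by linarith)
      (sub_nonpos.2 (max_le_max (neg_le_neg h) le_rfl))

end MixedOperator

/-! ### The weak maximum principle -/

open MeasureTheory MixedOperator

theorem theorem1p2 (N : ℕ) [NeZero N] (s : ℝ) (hs0 : 0 < s) (hs1 : s < 1)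
    (Ω : Set (EuclideanSpace ℝ (Fin N))) (hΩ : IsOpen Ω) (hbdd : Bornology.IsBounded Ω)
    (hC1 : MixedOperator.HasC1Boundary Ω)
    (u : EuclideanSpace ℝ (Fin N) → ℝ) (hu : MixedOperator.MemH1 u)
    (hsup : MixedOperator.WeaklyGE s Ω u (fun _ => 0))
    (hext : ∀ᵐ x ∂MeasureTheory.volume, x ∉ Ω → 0 ≤ u x) :
    ∀ᵐ x ∂MeasureTheory.volume, x ∈ Ω → 0 ≤ u x := by
  obtain ⟨hv, hgrad⟩ := hu.negPart
  set v : Space N → ℝ := fun x => max (-u x) 0 with hv_def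
  have hvΩ : ∀ᵐ x, x ∉ Ω → v x = 0 := by
    filter_upwards [hext] with x hx hxΩ
    exact max_eq_right (neg_nonpos.2 (hx hxΩ))
  have htest := hsup v ⟨hv, hvΩ⟩ (Filter.Eventually.of_forall fun x => le_max_right _ _)
  simp only [zero_mul, integral_zero, weakForm] at htest
  -- No integrability is needed for the sign of the nonlocal term.
  have hnonlocal : ∫ p : Space N × Space N,
      (u p.1 - u p.2) * (v p.1 - v p.2) / ‖p.1 - p.2‖ ^ ((N : ℝ) + 2 * s) ≤ 0 :=
    integral_nonpos fun p => div_nonpos_of_nonpos_of_nonneg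
      (sub_mul_max_neg_sub_nonpos (u p.1) (u p.2)) (Real.rpow_nonneg (norm_nonneg _) _)
  -- `∇v = -1_{u < 0} ∇u` turns the local term into minus the Dirichlet energy of `v` on `Ω`.
  have hlocal : ∫ x in Ω, inner ℝ (weakGradient u x) (weakGradient v x)
      = - ∫ x in Ω, ‖weakGradient v x‖ ^ 2 := by
    rw [← integral_neg]
    refine integral_congr_ae (ae_restrict_of_ae ?_)
    filter_upwards [hgrad] with x hx
    simp only [hx]
    split_ifs <;> simp
  have hle : ∫ x in Ω, ‖weakGradient v x‖ ^ 2 ≤ 0 := by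
    have := mul_nonpos_of_nonneg_of_nonpos
      (div_nonneg (fracConst_nonneg N s) zero_le_two) hnonlocal
    linarith
  have hint : IntegrableOn (fun x => ‖weakGradient v x‖ ^ 2) Ω :=
    (hv.memLp_weakGradient.integrable_norm_pow two_ne_zero).integrableOn
  have hΩ0 := (setIntegral_eq_zero_iff_of_nonneg_ae
    (Filter.Eventually.of_forall fun x => sq_nonneg _) hint).1
    (le_antisymm hle (integral_nonneg fun x => sq_nonneg _))
  have hgrad0 : ∀ᵐ x, weakGradient v x = 0 := by
    filter_upwards [(ae_restrict_iff' hΩ.measurableSet).1 hΩ0, hgrad, hext] with x h1 h2 h3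
    by_cases hx : x ∈ Ω
    · simpa using h1 hx
    · rw [h2, if_neg (not_lt.2 (h3 hx)), zero_smul]
  have hderiv := hv.hasWeakGradient.hasWeakLineDeriv (0 : Fin N)
  have hderiv0 : HasWeakLineDeriv volume v (fun _ => 0) (EuclideanSpace.single (0 : Fin N) 1) := by
    refine ⟨hderiv.locallyIntegrable, locallyIntegrable_const 0, fun φ hφ hφs => ?_⟩
    rw [hderiv.integral_eq φ hφ hφs, neg_inj]
    refine integral_congr_ae ?_
    filter_upwards [hgrad0] with x hx
    simp [hx]
  filter_upwards [hderiv0.ae_eq_zero_of_bounded (by simp) hbdd hvΩ] with x hx _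
  have : -u x ≤ 0 := hx ▸ le_max_left (-u x) 0
  linarith
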